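/- Let $q\in\mathbb C$ with $0<|q|<1$. For $a\in\mathbb C$ put $(a)_\infty=\prod_{j\ge 0}(1-aq^j)$, and for $k\in\mathbb Z$ let $(a)_k=(a)_\infty/(aq^k)_\infty$, i.e. $(a)_n=\prod_{j=0}^{n-1}(1-aq^j)$ and $(a)_{-n}=\prod_{j=1}^{n}(1-aq^{-j})^{-1}$ for integers $n\ge 0$. Write $(a_1,\dots,a_m)_k=(a_1)_k\cdots(a_m)_k$ for $k\in\mathbb Z\cup\{\infty\}$, and $${}_s\psi_s\!\left[\begin{matrix}a_1,\dots,a_s\\ b_1,\dots,b_s\end{matrix};q,z\right]=\sum_{k=-\infty}^{\infty}\frac{(a_1,\dots,a_s)_k}{(b_1,\dots,b_s)_k}z^k .$$ **Bailey's very-well-poised ${}_6\psi_6$ summation.** Let $a,b,c,d,e$ be nonzero complex numbers with $a\ne 1$ and $|a^2q/bcde|<1$, and assume that no denominator vanishes, that is, none of $b,c,d,e$ is of the form $q^{n}$ or $aq^{n}$ with an integer $n\ge 1$. Let $\sqrt a$ be either square root of $a$. Then $${}_6\psi_6\!\left[\begin{matrix}q\sqrt a,-q\sqrt a,b,c,d,e\\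 \sqrt a,-\sqrt a,aq/b,aq/c,aq/d,aq/e\end{matrix};q,\frac{qa^2}{bcde}\right] =\frac{(q,aq,q/a,aq/bc,aq/bd,aq/be,aq/cd,aq/ce,aq/de)_\infty}{(q/b,q/c,q/d,q/e,aq/b,aq/c,aq/d,aq/e,a^2q/bcde)_\infty},$$ where the series converges absolutely. Here the series is taken literally if $a\ne q^{2m}$ for all integers $m$; in general (including $a=q^{2m}$ with $m\ne 0$, when the factors containing $\sqrt a$ can be singular) the same holds with the quotient $(q\sqrt a,-q\sqrt a)_k/(\sqrt a,-\sqrt a)_k$ read as $(1-aq^{2k})/(1-a)$. -/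

import Mathlib

open scoped BigOperators

noncomputable section

/-- The infinite `q`-shifted factorial `(a; q)_∞ = ∏_{j ≥ 0} (1 - a q^j)`. -/
def qPochInf (q a : ℂ) : ℂ := ∏' j : ℕ, (1 - a * q ^ j)

/-- Multi-parameter notation: `(a₁, …, a_m; q)_∞ = (a₁; q)_∞ ⋯ (a_m; q)_∞`. -/
def qPochInfs (q : ℂ) (L : List ℂ) : ℂ := (L.map (qPochInf q)).prod

/-- The `q`-shifted factorial `(a; q)_k` for an integer `k`:
`(a; q)_n = ∏_{0 ≤ j < n} (1 - a q^j)` and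
`(a; q)_{-n} = 1 / ∏_{1 ≤ j ≤ n} (1 - a q^{-j})` for natural numbers `n`.
It is `(a; q)_∞ / (a q^k; q)_∞` wherever that quotient makes sense, see
`qPoch_eq_div`; unlike the quotient it is also right for `a = q^{-m}`,
where numerator and denominator can both vanish. -/
def qPoch (q a : ℂ) : ℤ → ℂ
  | Int.ofNat n => ∏ j ∈ Finset.range n, (1 - a * q ^ j)
  | Int.negSucc n => (∏ j ∈ Finset.range (n + 1), (1 - a * q ^ (-((j : ℤ) + 1))))⁻¹

/-- The `k`-th term of the bilateral basic hypergeometric series `ₛψₛ[A; B; q, z]`. -/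
def bilateralTerm {s : ℕ} (A B : Fin s → ℂ) (q z : ℂ) (k : ℤ) : ℂ :=
  (∏ i, qPoch q (A i) k) / (∏ i, qPoch q (B i) k) * z ^ k

/-- The bilateral basic hypergeometric series `ₛψₛ[A; B; q, z]`. -/
def bilateralPsi {s : ℕ} (A B : Fin s → ℂ) (q z : ℂ) : ℂ :=
  ∑' k : ℤ, bilateralTerm A B q z k

theorem qPochInf_multipliable {q : ℂ} (hq : ‖q‖ < 1) (a : ℂ) :
    Multipliable (fun j : ℕ => 1 - a * q ^ j) := by
  have h : Summable (fun j : ℕ => ‖-(a * q ^ j)‖) := by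
    simp only [norm_neg, norm_mul, norm_pow]
    exact (summable_geometric_of_lt_one (norm_nonneg q) hq).mul_left _
  simpa [sub_eq_add_neg] using multipliable_one_add_of_summable h

theorem qPochInf_step {q : ℂ} (hq : ‖q‖ < 1) (a : ℂ) :
    qPochInf q a = (1 - a) * qPochInf q (a * q) := by
  have h' : Multipliable (fun j : ℕ => 1 - a * q ^ (j + 1)) := by
    refine (qPochInf_multipliable hq (a * q)).congr fun j => ?_
    rw [pow_succ']
    ring
  have h2 : ∏' j : ℕ, (1 - a * q ^ j) = (1 - a * q ^ 0) * ∏' j : ℕ, (1 - a * q ^ (j + 1)) :=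
    tprod_eq_zero_mul' (f := fun j : ℕ => 1 - a * q ^ j) h'
  have h3 : ∏' j : ℕ, (1 - a * q ^ (j + 1)) = ∏' j : ℕ, (1 - a * q * q ^ j) :=
    tprod_congr fun j => by rw [pow_succ']; ring
  rw [qPochInf, qPochInf, h2, h3, pow_zero, mul_one]

theorem qPochInf_eq_prod_mul {q : ℂ} (hq : ‖q‖ < 1) (a : ℂ) (n : ℕ) :
    qPochInf q a = (∏ j ∈ Finset.range n, (1 - a * q ^ j)) * qPochInf q (a * q ^ n) := by
  induction n with
  | zero => simp
  | succ n ih =>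
    rw [ih, Finset.prod_range_succ, qPochInf_step hq (a * q ^ n), pow_succ]
    ring_nf

/-- `(a; q)_k = (a; q)_∞ / (a q^k; q)_∞` whenever the denominator is not zero. -/
theorem qPoch_eq_div {q : ℂ} (hq0 : q ≠ 0) (hq : ‖q‖ < 1) (a : ℂ) (k : ℤ)
    (h : qPochInf q (a * q ^ k) ≠ 0) :
    qPoch q a k = qPochInf q a / qPochInf q (a * q ^ k) := by
  rw [eq_div_iff h]
  cases k with
  | ofNat n =>
    simpa [qPoch] using (qPochInf_eq_prod_mul hq a n).symm
  | negSucc n =>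
    have key := qPochInf_eq_prod_mul hq (a * q ^ (Int.negSucc n)) (n + 1)
    have e1 : a * q ^ (Int.negSucc n) * q ^ (n + 1) = a := by
      rw [zpow_negSucc]
      field_simp
    have e2 : ∏ j ∈ Finset.range (n + 1), (1 - a * q ^ (Int.negSucc n) * q ^ j)
        = ∏ j ∈ Finset.range (n + 1), (1 - a * q ^ (-((j : ℤ) + 1))) := by
      rw [← Finset.prod_range_reflect]
      refine Finset.prod_congr rfl fun j hj => ?_
      have hj' : j ≤ n := Nat.lt_succ_iff.mp (Finset.mem_range.mp hj)
      rw [mul_assoc, ← zpow_natCast q, ← zpow_add₀ hq0]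
      congr 3
      rw [Int.negSucc_eq]
      omega
    rw [e1, e2] at key
    have hP : (∏ j ∈ Finset.range (n + 1), (1 - a * q ^ (-((j : ℤ) + 1)))) ≠ 0 := by
      intro h0
      rw [h0, zero_mul] at key
      exact h key
    show (∏ j ∈ Finset.range (n + 1), (1 - a * q ^ (-((j : ℤ) + 1))))⁻¹ * _ = _
    rw [key, inv_mul_cancel_left₀ hP]

end

noncomputable section

open Filter Topology

/-! In the reciprocal parameters β = 1/b, γ = 1/c, δ = 1/d, ε = 1/e the terms still make sense when
a parameter is 0, and the series becomes `vwpSum` divided by 1 - a. Its terms satisfy a contiguous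
relation: a combination of the terms at ε and at εq is a difference in k of the certificate
`vwpCert` (`vwpTerm_contiguous`). Summation over all integers kills the difference, so the sums at ε
and εq are related by explicit factors, exactly those that relate the products `vwpDen` and `vwpNum`
at ε and εq.

By symmetry every parameter can be shifted. After m rounds all four are multiplied by q^m, and
dominated convergence as m → ∞ leaves only an unknown constant, the sum with all parameters 0
(`vwpSum_mul_vwpDen`).

That constant depends on a and q alone, and the identity itself determines it: at the parameters (0,
0, 1, 1/a) the series terminates on both sides and only k = 0 survives (`vwpSum_terminating`). This
choice is forbidden when a = q^N with N ≠ 0, but then the constant vanishes by antisymmetry, as does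
the product claimed for it (`vwpSum_zero`). The value is a form of Jacobi's triple product, obtained
here as a by-product. -/

/-! ### Infinite q-products: behaviour near 0 and zeros. -/

theorem norm_qPochInf_sub_one_le {q : ℂ} (hq : ‖q‖ < 1) (x : ℂ) :
    ‖qPochInf q x - 1‖ ≤ Real.exp (‖x‖ * (1 - ‖q‖)⁻¹) - 1 := by
  have h1 : Tendsto (fun s : Finset ℕ => ‖∏ j ∈ s, (1 - x * q ^ j) - 1‖) atTop
      (𝓝 ‖qPochInf q x - 1‖) :=
    (((qPochInf_multipliable hq x).hasProd).sub_const 1).norm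
  refine le_of_tendsto' h1 fun s => ?_
  have h2 := s.norm_prod_one_add_sub_one_le (fun j => -(x * q ^ j))
  simp only [← sub_eq_add_neg, norm_neg, norm_mul, norm_pow] at h2
  refine h2.trans ?_
  have h3 : ∑ i ∈ s, ‖x‖ * ‖q‖ ^ i ≤ ‖x‖ * (1 - ‖q‖)⁻¹ := by
    rw [← tsum_geometric_of_lt_one (norm_nonneg q) hq, ← tsum_mul_left]
    exact ((summable_geometric_of_lt_one (norm_nonneg q) hq).mul_left _).sum_le_tsum s
      fun _ _ => by positivity
  gcongr

theorem tendsto_qPochInf_one {q : ℂ} (hq : ‖q‖ < 1) {u : ℕ → ℂ} (hu : Tendsto u atTop (𝓝 0)) :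
    Tendsto (fun m => qPochInf q (u m)) atTop (𝓝 1) := by
  rw [tendsto_iff_norm_sub_tendsto_zero]
  have h : Tendsto (fun m => Real.exp (‖u m‖ * (1 - ‖q‖)⁻¹) - 1) atTop (𝓝 0) := by
    have := ((Real.continuous_exp.tendsto _).comp (hu.norm.mul_const (1 - ‖q‖)⁻¹)).sub_const 1
    simpa [Function.comp_def] using this
  exact squeeze_zero (fun _ => norm_nonneg _) (fun m => norm_qPochInf_sub_one_le hq _) h

theorem qPochInf_ne_zero {q : ℂ} (hq : ‖q‖ < 1) {x : ℂ} (hx : ∀ j : ℕ, x * q ^ j ≠ 1) :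
    qPochInf q x ≠ 0 := by
  have h := tprod_one_add_ne_zero_of_summable (R := ℂ) (f := fun j : ℕ => -(x * q ^ j))
    (fun j => by rw [← sub_eq_add_neg, sub_ne_zero]; exact (hx j).symm)
    (by
      simp only [norm_neg, norm_mul, norm_pow]
      exact (summable_geometric_of_lt_one (norm_nonneg q) hq).mul_left _)
  simpa only [qPochInf, ← sub_eq_add_neg] using h

theorem qPochInf_zero (q : ℂ) : qPochInf q 0 = 1 := by simp [qPochInf]

theorem qPochInf_eq_zero {q : ℂ} (hq : ‖q‖ < 1) {x : ℂ} {j : ℕ} (hx : x * q ^ j = 1) :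
    qPochInf q x = 0 := by
  rw [qPochInf_eq_prod_mul hq x (j + 1), Finset.prod_range_succ, hx]
  simp

/-! ### Well-poised factors in a reciprocal parameter. -/

/-- The ratio `(1/β; q)_k / (aqβ; q)_k * β ^ k`, written so that it makes sense for `β = 0`. -/
def wpFactor (q a β : ℂ) : ℤ → ℂ
  | Int.ofNat n => ∏ j ∈ Finset.range n, ((β - q ^ j) / (1 - a * β * q ^ (j + 1)))
  | Int.negSucc n =>
      ∏ j ∈ Finset.range (n + 1), ((a * β * q - q ^ (j + 1)) / (1 - β * q ^ (j + 1)))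

/-- No denominator of `wpFactor q a β` vanishes. -/
def WpRegular (q a β : ℂ) : Prop := ∀ n : ℕ, 1 - β * q ^ (n + 1) ≠ 0 ∧ 1 - a * β * q ^ (n + 1) ≠ 0

theorem WpRegular.reflect {q a β : ℂ} (ha : a ≠ 0) (h : WpRegular q a β) :
    WpRegular q a⁻¹ (a * β) := fun n =>
  ⟨(h n).2, by rw [inv_mul_cancel_left₀ ha]; exact (h n).1⟩

theorem WpRegular.mul_q {q a β : ℂ} (h : WpRegular q a β) : WpRegular q a (β * q) := fun n => by
  have := h (n + 1)
  rw [pow_succ' q (n + 1)] at this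
  simpa only [mul_assoc] using this

theorem wpFactor_natCast (q a β : ℂ) (n : ℕ) :
    wpFactor q a β n = ∏ j ∈ Finset.range n, ((β - q ^ j) / (1 - a * β * q ^ (j + 1))) := rfl

@[simp] theorem wpFactor_zero (q a β : ℂ) : wpFactor q a β 0 = 1 := by
  simpa using wpFactor_natCast q a β 0

theorem wpFactor_natCast_succ (q a β : ℂ) (n : ℕ) :
    wpFactor q a β ((n + 1 : ℕ) : ℤ)
      = wpFactor q a β n * ((β - q ^ n) / (1 - a * β * q ^ (n + 1))) := by
  rw [wpFactor_natCast, wpFactor_natCast, Finset.prod_range_succ]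

/-- Reversing k amounts to the symmetry a ↦ 1/a, β ↦ aβ, which exchanges the two conditions in
`WpRegular`. It reduces statements about negative k to natural indices. -/
theorem wpFactor_neg {q a : ℂ} (ha : a ≠ 0) (β : ℂ) (n : ℕ) :
    wpFactor q a β (-(n : ℤ)) = q ^ n * wpFactor q a⁻¹ (a * β) n := by
  cases n with
  | zero => simp
  | succ n =>
    rw [show (-((n + 1 : ℕ) : ℤ)) = Int.negSucc n from rfl, wpFactor_natCast, wpFactor,
      ← Finset.card_range (n + 1), ← Finset.prod_const, Finset.card_range,
      ← Finset.prod_mul_distrib]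
    refine Finset.prod_congr rfl fun j _ => ?_
    rw [inv_mul_cancel_left₀ ha, pow_succ, mul_div_assoc']
    congr 1
    ring

theorem wpFactor_add_one {q a β : ℂ} (hq0 : q ≠ 0) (ha : a ≠ 0) (h : WpRegular q a β) (k : ℤ) :
    (1 - a * β * q ^ (k + 1)) * wpFactor q a β (k + 1) = (β - q ^ k) * wpFactor q a β k := by
  obtain ⟨n, rfl | rfl⟩ := k.eq_nat_or_neg
  · have h1 := wpFactor_natCast_succ q a β n
    push_cast at h1
    have h2 : (q : ℂ) ^ ((n : ℤ) + 1) = q ^ (n + 1) := by exact_mod_cast zpow_natCast q (n + 1)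
    rw [h1, h2, zpow_natCast]
    have := (h n).2
    field_simp
  · cases n with
    | zero =>
      have h1 := wpFactor_natCast_succ q a β 0
      have := (h 0).2
      simp at h1 this ⊢
      rw [h1]
      field_simp
    | succ n =>
      have e : -((n + 1 : ℕ) : ℤ) + 1 = -(n : ℤ) := by push_cast; ring
      rw [e, wpFactor_neg ha, wpFactor_neg ha, wpFactor_natCast_succ, zpow_neg, zpow_neg,
        zpow_natCast, zpow_natCast, inv_mul_cancel_left₀ ha]
      have := (h n).1
      field_simp
      ring

theorem wpFactor_mul_q_natCast {q a β : ℂ} (h : WpRegular q a β) (n : ℕ) :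
    (β * q - 1) * (1 - a * β * q) * q ^ n * wpFactor q a β n
      = (β * q - q ^ n) * (1 - a * β * q ^ (n + 1)) * wpFactor q a (β * q) n := by
  induction n with
  | zero => simp
  | succ n ih =>
    rw [wpFactor_natCast_succ, wpFactor_natCast_succ]
    have h1 := (h n).2
    have h2 := (h (n + 1)).2
    have h3 : 1 - a * (β * q) * q ^ (n + 1) = 1 - a * β * q ^ (n + 1 + 1) := by ring
    rw [h3, mul_div_assoc', mul_div_assoc', mul_div_assoc', mul_div_assoc', div_eq_div_iff h1 h2]
    linear_combination ((β - q ^ n) * q * (1 - a * β * q ^ (n + 1 + 1))) * ih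

/-- Passing from β to βq moves every factor of the products by one place, so only end factors
differ. The cross-multiplied form also covers βq = q^k. -/
theorem wpFactor_mul_q {q a β : ℂ} (hq0 : q ≠ 0) (ha : a ≠ 0) (h : WpRegular q a β) (k : ℤ) :
    (β * q - 1) * (1 - a * β * q) * q ^ k * wpFactor q a β k
      = (β * q - q ^ k) * (1 - a * β * q ^ (k + 1)) * wpFactor q a (β * q) k := by
  obtain ⟨n, rfl | rfl⟩ := k.eq_nat_or_neg
  · have h2 : (q : ℂ) ^ ((n : ℤ) + 1) = q ^ (n + 1) := by exact_mod_cast zpow_natCast q (n + 1)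
    rw [h2, zpow_natCast, wpFactor_mul_q_natCast h]
  · have h1 := wpFactor_mul_q_natCast (h.reflect ha) n
    rw [wpFactor_neg ha, wpFactor_neg ha, zpow_add₀ hq0, zpow_one, zpow_neg, zpow_natCast,
      ← mul_assoc a β q]
    rw [inv_mul_cancel_left₀ ha] at h1
    have hn : q ^ n ≠ 0 := pow_ne_zero _ hq0
    generalize wpFactor q a⁻¹ (a * β) n = x at *
    generalize wpFactor q a⁻¹ (a * β * q) n = y at *
    field_simp
    linear_combination h1

/-! ### Convergence, and the limit of vanishing parameters. -/

theorem tendsto_pow_zero {q : ℂ} (hq : ‖q‖ < 1) : Tendsto (fun n : ℕ => q ^ n) atTop (𝓝 0) :=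
  tendsto_pow_atTop_nhds_zero_of_norm_lt_one hq

theorem tendsto_wpRatio {q : ℂ} (hq : ‖q‖ < 1) (a β : ℂ) :
    Tendsto (fun n : ℕ => (β - q ^ n) / (1 - a * β * q ^ (n + 1))) atTop (𝓝 β) := by
  have h1 := (tendsto_pow_zero hq).const_sub β
  have h2 := (((tendsto_add_atTop_iff_nat 1).2 (tendsto_pow_zero hq)).const_mul (a * β)).const_sub 1
  have h3 := h1.div h2 (by simp)
  simp only [mul_zero, sub_zero, div_one] at h3
  exact h3

theorem summable_wpFactor {q : ℂ} (hq : ‖q‖ < 1) (a w β γ δ ε : ℂ)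
    (hw : ‖w * (β * γ * δ * ε)‖ < 1) :
    Summable fun n : ℕ => w ^ n * (wpFactor q a β n * wpFactor q a γ n * wpFactor q a δ n
      * wpFactor q a ε n) := by
  obtain ⟨r, hr, hr1⟩ := exists_between hw
  have ht := (((((tendsto_wpRatio hq a β).mul (tendsto_wpRatio hq a γ)).mul
    (tendsto_wpRatio hq a δ)).mul (tendsto_wpRatio hq a ε)).const_mul w).norm
  refine summable_of_ratio_norm_eventually_le hr1 ?_
  filter_upwards [ht.eventually (gt_mem_nhds hr)] with n hn
  simp only [wpFactor_natCast_succ]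
  have : ∀ p1 p2 p3 p4 r1 r2 r3 r4 : ℂ, w ^ (n + 1) * (p1 * r1 * (p2 * r2) * (p3 * r3) * (p4 * r4))
      = (w * (r1 * r2 * r3 * r4)) * (w ^ n * (p1 * p2 * p3 * p4)) := by intros; ring
  rw [this, norm_mul]
  exact mul_le_mul_of_nonneg_right hn.le (norm_nonneg _)

/-- Numerators are at most η + |q|^j and denominators at least 1/2. The bound is uniform in β, as
dominated convergence requires. -/
theorem norm_wpFactor_le {q a β : ℂ} {η : ℝ} (hη : η ≤ 1 / 2) (hq : ‖q‖ < 1) (hβ : ‖β‖ ≤ η)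
    (haβ : ‖a * β‖ ≤ η) (n : ℕ) :
    ‖wpFactor q a β n‖ ≤ ∏ j ∈ Finset.range n, (2 * (η + ‖q‖ ^ j)) := by
  rw [wpFactor_natCast, norm_prod]
  refine Finset.prod_le_prod (fun _ _ => norm_nonneg _) fun j _ => ?_
  have h1 : ‖β - q ^ j‖ ≤ η + ‖q‖ ^ j := by
    refine (norm_sub_le _ _).trans ?_
    rw [norm_pow]
    gcongr
  have h2 : 1 / 2 ≤ ‖1 - a * β * q ^ (j + 1)‖ := by
    have h3 := norm_sub_norm_le 1 (a * β * q ^ (j + 1))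
    have h4 : ‖a * β * q ^ (j + 1)‖ ≤ 1 / 2 * 1 := by
      rw [norm_mul, norm_pow]
      exact mul_le_mul (haβ.trans hη) (pow_le_one₀ (norm_nonneg _) hq.le) (by positivity)
        (by norm_num)
    rw [norm_one] at h3
    linarith
  rw [norm_div, div_le_iff₀ (by linarith)]
  have h5 : 0 ≤ η + ‖q‖ ^ j := (norm_nonneg _).trans h1
  nlinarith

theorem summable_wpBound {q : ℂ} (hq : ‖q‖ < 1) {W η : ℝ} (hW : 0 ≤ W)
    (h : W * (2 * η) ^ 4 < 1) :
    Summable fun n : ℕ => W ^ n * (∏ j ∈ Finset.range n, (2 * (η + ‖q‖ ^ j))) ^ 4 := by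
  obtain ⟨r, hr, hr1⟩ := exists_between h
  have ht : Tendsto (fun n : ℕ => W * (2 * (η + ‖q‖ ^ n)) ^ 4) atTop (𝓝 (W * (2 * η) ^ 4)) := by
    simpa using ((((tendsto_pow_atTop_nhds_zero_of_lt_one (norm_nonneg q) hq).const_add
      η).const_mul 2).pow 4).const_mul W
  refine summable_of_ratio_norm_eventually_le hr1 ?_
  filter_upwards [ht.eventually (gt_mem_nhds hr)] with n hn
  rw [Finset.prod_range_succ, show ∀ p s : ℝ, W ^ (n + 1) * (p * s) ^ 4
    = (W * s ^ 4) * (W ^ n * p ^ 4) by intros; ring, norm_mul]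
  refine mul_le_mul_of_nonneg_right ?_ (norm_nonneg _)
  rw [Real.norm_of_nonneg (mul_nonneg hW (by positivity))]
  exact hn.le

theorem tendsto_wpFactor {q : ℂ} (a : ℂ) {u : ℕ → ℂ} (hu : Tendsto u atTop (𝓝 0)) (n : ℕ) :
    Tendsto (fun m => wpFactor q a (u m) n) atTop (𝓝 (wpFactor q a 0 n)) := by
  simp only [wpFactor_natCast]
  refine tendsto_finsetProd _ fun j _ => ?_
  have h1 := hu.sub_const (q ^ j)
  have h2 := ((hu.const_mul a).mul_const (q ^ (j + 1))).const_sub 1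
  exact h1.div h2 (by simp)

/-- The term of the very-well-poised series in the reciprocal parameters
`β = 1/b`, `γ = 1/c`, `δ = 1/d`, `ε = 1/e`. -/
def vwpTerm (q a β γ δ ε : ℂ) (k : ℤ) : ℂ :=
  (1 - a * q ^ (2 * k)) * ((a ^ 2 * q) ^ k *
    (wpFactor q a β k * wpFactor q a γ k * wpFactor q a δ k * wpFactor q a ε k))

theorem vwpTerm_neg {q a : ℂ} (hq0 : q ≠ 0) (ha : a ≠ 0) (β γ δ ε : ℂ) (n : ℕ) :
    vwpTerm q a β γ δ ε (-(n : ℤ))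
      = -a * vwpTerm q a⁻¹ (a * β) (a * γ) (a * δ) (a * ε) n := by
  simp only [vwpTerm, wpFactor_neg ha]
  generalize wpFactor q a⁻¹ (a * β) n = x1
  generalize wpFactor q a⁻¹ (a * γ) n = x2
  generalize wpFactor q a⁻¹ (a * δ) n = x3
  generalize wpFactor q a⁻¹ (a * ε) n = x4
  have e1 : q ^ (2 * (-(n : ℤ))) = ((q ^ n) ^ 2)⁻¹ := by
    rw [mul_comm, zpow_mul, zpow_neg, zpow_natCast]
    simp [zpow_ofNat]
  have e2 : q ^ (2 * (n : ℤ)) = (q ^ n) ^ 2 := by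
    rw [mul_comm, zpow_mul, zpow_natCast, zpow_ofNat]
  have e3 : (a ^ 2) ^ n = (a ^ n) ^ 2 := by rw [← pow_mul, mul_comm, pow_mul]
  rw [e1, e2, zpow_neg, zpow_natCast, zpow_natCast, mul_pow, mul_pow, inv_pow a 2,
    inv_pow (a ^ 2) n, e3]
  have h1 : q ^ n ≠ 0 := pow_ne_zero _ hq0
  have h2 : a ^ n ≠ 0 := pow_ne_zero _ ha
  generalize q ^ n = y at *
  generalize a ^ n = z at *
  field_simp
  ring

theorem summable_mul_of_norm_le {f g : ℕ → ℂ} {C : ℝ} (hf : Summable f) (hg : ∀ n, ‖g n‖ ≤ C) :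
    Summable fun n => g n * f n := by
  refine Summable.of_norm_bounded (hf.norm.mul_left C) fun n => ?_
  rw [norm_mul]
  exact mul_le_mul_of_nonneg_right (hg n) (norm_nonneg _)

theorem norm_one_sub_mul_le {q : ℂ} (hq : ‖q‖ < 1) (x : ℂ) (n : ℕ) :
    ‖1 - x * q ^ n‖ ≤ 1 + ‖x‖ := by
  refine (norm_sub_le _ _).trans ?_
  rw [norm_one, norm_mul, norm_pow]
  have := mul_le_of_le_one_right (norm_nonneg x) (pow_le_one₀ (n := n) (norm_nonneg q) hq.le)
  linarith

theorem zpow_two_mul_natCast (q : ℂ) (n : ℕ) : q ^ (2 * (n : ℤ)) = q ^ (2 * n) := by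
  exact_mod_cast zpow_natCast q (2 * n)

theorem summable_vwpTerm_natCast {q : ℂ} (hq : ‖q‖ < 1) {a β γ δ ε : ℂ}
    (hz : ‖a ^ 2 * q * (β * γ * δ * ε)‖ < 1) :
    Summable fun n : ℕ => vwpTerm q a β γ δ ε n := by
  have h := summable_mul_of_norm_le (summable_wpFactor hq a (a ^ 2 * q) β γ δ ε hz)
    fun n => norm_one_sub_mul_le hq a (2 * n)
  simpa only [vwpTerm, zpow_natCast, zpow_two_mul_natCast] using h

theorem inv_argument_eq {a : ℂ} (ha : a ≠ 0) (q β γ δ ε : ℂ) :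
    a⁻¹ ^ 2 * q * (a * β * (a * γ) * (a * δ) * (a * ε)) = a ^ 2 * q * (β * γ * δ * ε) := by
  field_simp

/-- The very-well-poised bilateral sum. -/
def vwpSum (q a β γ δ ε : ℂ) : ℂ := ∑' k : ℤ, vwpTerm q a β γ δ ε k

theorem hasSum_vwpTerm {q a β γ δ ε : ℂ} (hq0 : q ≠ 0) (hq : ‖q‖ < 1) (ha : a ≠ 0)
    (hz : ‖a ^ 2 * q * (β * γ * δ * ε)‖ < 1) :
    HasSum (vwpTerm q a β γ δ ε) ((∑' n : ℕ, vwpTerm q a β γ δ ε n)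
      + -a * (∑' n : ℕ, vwpTerm q a⁻¹ (a * β) (a * γ) (a * δ) (a * ε) n) - (1 - a)) := by
  have h1 := (summable_vwpTerm_natCast hq hz).hasSum
  have h2 := ((summable_vwpTerm_natCast hq ((inv_argument_eq ha q β γ δ ε).symm ▸ hz)).hasSum).mul_left
    (-a)
  simp only [← vwpTerm_neg hq0 ha] at h2
  -- Both halves contain k = 0, so the central term 1 - a is subtracted once.
  have h3 := h1.of_nat_of_neg h2
  have h0 : vwpTerm q a β γ δ ε 0 = 1 - a := by simp [vwpTerm]
  rwa [h0] at h3

theorem tendsto_tsum_vwpTerm {q : ℂ} (hq : ‖q‖ < 1) (a β γ δ ε : ℂ) :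
    Tendsto (fun m : ℕ => ∑' n : ℕ, vwpTerm q a (β * q ^ m) (γ * q ^ m) (δ * q ^ m) (ε * q ^ m) n)
      atTop (𝓝 (∑' n : ℕ, vwpTerm q a 0 0 0 0 n)) := by
  -- The dominating series has limiting ratio ‖a²q‖(2η)⁴, so η is taken small enough to make this
  -- less than 1.
  obtain ⟨η, hη0, hη1, hη2⟩ : ∃ η : ℝ, 0 < η ∧ η ≤ 1 / 2 ∧ ‖a ^ 2 * q‖ * (2 * η) ^ 4 < 1 := by
    have h1 : Tendsto (fun η : ℝ => ‖a ^ 2 * q‖ * (2 * η) ^ 4) (𝓝[>] 0) (𝓝 0) := by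
      have : ContinuousAt (fun η : ℝ => ‖a ^ 2 * q‖ * (2 * η) ^ 4) 0 := by fun_prop
      have h := this.tendsto
      simp only [mul_zero, ne_eq, OfNat.ofNat_ne_zero, not_false_eq_true, zero_pow] at h
      exact h.mono_left nhdsWithin_le_nhds
    obtain ⟨η, h2, h3, h4⟩ := ((h1.eventually (gt_mem_nhds one_pos)).and
      (Ioc_mem_nhdsGT (show (0 : ℝ) < 1 / 2 by norm_num))).exists
    exact ⟨η, h3, h4, h2⟩
  have hu : ∀ x : ℂ, Tendsto (fun m : ℕ => x * q ^ m) atTop (𝓝 0) := fun x => by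
    simpa using (tendsto_pow_zero hq).const_mul x
  have hsmall : ∀ x : ℂ, ∀ᶠ m : ℕ in atTop, ‖x * q ^ m‖ ≤ η := fun x => by
    have h := (hu x).norm
    rw [norm_zero] at h
    exact (h.eventually (gt_mem_nhds hη0)).mono fun _ => le_of_lt
  have hev : ∀ x : ℂ, ∀ᶠ m : ℕ in atTop, ∀ n : ℕ, ‖wpFactor q a (x * q ^ m) n‖
      ≤ ∏ j ∈ Finset.range n, (2 * (η + ‖q‖ ^ j)) := fun x => by
    filter_upwards [hsmall x, hsmall (a * x)] with m h1 h2 n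
    exact norm_wpFactor_le hη1 hq h1 (by rwa [← mul_assoc]) n
  refine tendsto_tsum_of_dominated_convergence
    (bound := fun n => (1 + ‖a‖) * (‖a ^ 2 * q‖ ^ n *
      (∏ j ∈ Finset.range n, (2 * (η + ‖q‖ ^ j))) ^ 4))
    ((summable_wpBound hq (norm_nonneg _) hη2).mul_left _) (fun n => ?_) ?_
  · exact ((((tendsto_wpFactor a (hu β) n).mul (tendsto_wpFactor a (hu γ) n)).mul
      (tendsto_wpFactor a (hu δ) n)).mul (tendsto_wpFactor a (hu ε) n)).const_mul _ |>.const_mul _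
  · filter_upwards [hev β, hev γ, hev δ, hev ε] with m h1 h2 h3 h4 n
    rw [vwpTerm, zpow_two_mul_natCast, norm_mul, norm_mul, zpow_natCast, norm_pow, norm_mul,
      norm_mul, norm_mul (_ * _) (wpFactor _ _ _ _), norm_mul (wpFactor _ _ _ _)]
    have hp : 0 ≤ ∏ j ∈ Finset.range n, (2 * (η + ‖q‖ ^ j)) :=
      Finset.prod_nonneg fun _ _ => by positivity
    rw [show ∀ x : ℝ, x ^ 4 = x * x * x * x by intro; ring]
    gcongr
    · exact norm_one_sub_mul_le hq a (2 * n)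
    · exact h1 n
    · exact h2 n
    · exact h3 n
    · exact h4 n

theorem norm_argument_mul_lt {Z w : ℂ} (hZ : ‖Z‖ < 1) (hw : ‖w‖ ≤ 1) : ‖Z * w‖ < 1 := by
  rw [norm_mul]
  exact (mul_le_of_le_one_right (norm_nonneg _) hw).trans_lt hZ

theorem tendsto_vwpSum {q a β γ δ ε : ℂ} (hq0 : q ≠ 0) (hq : ‖q‖ < 1) (ha : a ≠ 0)
    (hz : ‖a ^ 2 * q * (β * γ * δ * ε)‖ < 1) :
    Tendsto (fun m : ℕ => vwpSum q a (β * q ^ m) (γ * q ^ m) (δ * q ^ m) (ε * q ^ m))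
      atTop (𝓝 (vwpSum q a 0 0 0 0)) := by
  have h1 : ∀ m : ℕ, ‖a ^ 2 * q * (β * q ^ m * (γ * q ^ m) * (δ * q ^ m) * (ε * q ^ m))‖ < 1 := by
    intro m
    have := norm_argument_mul_lt hz (w := (q ^ m) ^ 4)
      (by rw [norm_pow, norm_pow]; exact pow_le_one₀ (by positivity)
            (pow_le_one₀ (norm_nonneg _) hq.le))
    convert this using 2
    ring
  have h2 : ‖a ^ 2 * q * ((0 : ℂ) * 0 * 0 * 0)‖ < 1 := by simp
  simp only [vwpSum]
  rw [(hasSum_vwpTerm hq0 hq ha h2).tsum_eq]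
  simp only [fun m => (hasSum_vwpTerm hq0 hq ha (h1 m)).tsum_eq, mul_zero]
  have h3 := tendsto_tsum_vwpTerm hq a⁻¹ (a * β) (a * γ) (a * δ) (a * ε)
  simp only [mul_assoc a] at h3
  exact ((tendsto_tsum_vwpTerm hq a β γ δ ε).add (h3.const_mul _)).sub_const _

/-! ### The contiguous relation. -/

/-- The telescoping certificate of the contiguous relation. -/
def vwpCert (q a β γ δ ε : ℂ) (k : ℤ) : ℂ :=
  (a ^ 2) ^ k * ((1 - a * β * q ^ k) * wpFactor q a β k * ((1 - a * γ * q ^ k) * wpFactor q a γ k)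
    * ((1 - a * δ * q ^ k) * wpFactor q a δ k) * ((1 - a * ε * q ^ k) * wpFactor q a ε k))

theorem summable_vwpCert_natCast {q : ℂ} (hq : ‖q‖ < 1) {a β γ δ ε : ℂ}
    (hz : ‖a ^ 2 * (β * γ * δ * ε)‖ < 1) :
    Summable fun n : ℕ => vwpCert q a β γ δ ε n := by
  have h := summable_mul_of_norm_le (summable_wpFactor hq a (a ^ 2) β γ δ ε hz)
    (g := fun n => (1 - a * β * q ^ n) * (1 - a * γ * q ^ n) * (1 - a * δ * q ^ n)
      * (1 - a * ε * q ^ n))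
    (C := (1 + ‖a * β‖) * (1 + ‖a * γ‖) * (1 + ‖a * δ‖) * (1 + ‖a * ε‖)) fun n => by
      rw [norm_mul, norm_mul, norm_mul]
      gcongr <;> exact norm_one_sub_mul_le hq _ n
  refine h.congr fun n => ?_
  simp only [vwpCert, zpow_natCast]
  ring

/-- The index becomes n + 1 rather than n because 1 - aβq^(-n) is, up to -q^(-n), the numerator aβ -
q^n of the next factor in the reflected product. The four signs cancel. -/
theorem vwpCert_neg {q a β γ δ ε : ℂ} (hq0 : q ≠ 0) (ha : a ≠ 0) (hβ : WpRegular q a β)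
    (hγ : WpRegular q a γ) (hδ : WpRegular q a δ) (hε : WpRegular q a ε) (n : ℕ) :
    vwpCert q a β γ δ ε (-(n : ℤ))
      = a ^ 2 * vwpCert q a⁻¹ (a * β) (a * γ) (a * δ) (a * ε) ((n + 1 : ℕ) : ℤ) := by
  have key : ∀ x, WpRegular q a x → (1 - a * x * q ^ (-(n : ℤ))) * wpFactor q a x (-(n : ℤ))
      = -((1 - a⁻¹ * (a * x) * q ^ ((n + 1 : ℕ) : ℤ)) *
        wpFactor q a⁻¹ (a * x) ((n + 1 : ℕ) : ℤ)) := fun x hx => by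
    have h := wpFactor_add_one hq0 (inv_ne_zero ha) (hx.reflect ha) n
    push_cast
    rw [h, wpFactor_neg ha, zpow_neg, zpow_natCast]
    have := pow_ne_zero n hq0
    generalize wpFactor q a⁻¹ (a * x) n = y
    field_simp
    ring
  rw [vwpCert, vwpCert, key β hβ, key γ hγ, key δ hδ, key ε hε, zpow_neg]
  have : (a ^ 2) ^ n ≠ 0 := pow_ne_zero _ (pow_ne_zero _ ha)
  generalize (1 - a⁻¹ * (a * β) * q ^ ((n + 1 : ℕ) : ℤ)) *
        wpFactor q a⁻¹ (a * β) ((n + 1 : ℕ) : ℤ) = x1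
  generalize (1 - a⁻¹ * (a * γ) * q ^ ((n + 1 : ℕ) : ℤ)) *
        wpFactor q a⁻¹ (a * γ) ((n + 1 : ℕ) : ℤ) = x2
  generalize (1 - a⁻¹ * (a * δ) * q ^ ((n + 1 : ℕ) : ℤ)) *
        wpFactor q a⁻¹ (a * δ) ((n + 1 : ℕ) : ℤ) = x3
  generalize (1 - a⁻¹ * (a * ε) * q ^ ((n + 1 : ℕ) : ℤ)) *
        wpFactor q a⁻¹ (a * ε) ((n + 1 : ℕ) : ℤ) = x4
  rw [zpow_natCast, zpow_natCast, inv_pow a 2, inv_pow, pow_succ (a ^ 2) n]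
  field_simp

theorem summable_vwpCert {q a β γ δ ε : ℂ} (hq0 : q ≠ 0) (hq : ‖q‖ < 1) (ha : a ≠ 0)
    (hβ : WpRegular q a β) (hγ : WpRegular q a γ) (hδ : WpRegular q a δ) (hε : WpRegular q a ε)
    (hz : ‖a ^ 2 * (β * γ * δ * ε)‖ < 1) : Summable (vwpCert q a β γ δ ε) := by
  refine Summable.of_nat_of_neg (summable_vwpCert_natCast hq hz) ?_
  have hz' : ‖a⁻¹ ^ 2 * (a * β * (a * γ) * (a * δ) * (a * ε))‖ < 1 := by
    convert hz using 2
    field_simp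
  simp only [vwpCert_neg hq0 ha hβ hγ hδ hε]
  exact ((summable_nat_add_iff 1).2 (summable_vwpCert_natCast hq hz')).mul_left _

/-- The recurrence in k brings the certificate at k + 1 back to k, and `wpFactor_mul_q` links the
factors at ε and εq. What remains is a polynomial identity in q^k. -/
theorem vwpTerm_contiguous {q a β γ δ ε : ℂ} (hq0 : q ≠ 0) (ha : a ≠ 0)
    (hβ : WpRegular q a β) (hγ : WpRegular q a γ) (hδ : WpRegular q a δ) (hε : WpRegular q a ε)
    (k : ℤ) :
    (1 - ε * q) * (1 - a * ε * q) * (1 - a ^ 2 * q * (β * γ * δ * ε)) * vwpTerm q a β γ δ ε k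
      - (1 - a * q * (β * ε)) * (1 - a * q * (γ * ε)) * (1 - a * q * (δ * ε))
        * vwpTerm q a β γ δ (ε * q) k
      = ε * q * (vwpCert q a β γ δ (ε * q) (k + 1) - vwpCert q a β γ δ (ε * q) k) := by
  have h1 := wpFactor_add_one hq0 ha hβ k
  have h2 := wpFactor_add_one hq0 ha hγ k
  have h3 := wpFactor_add_one hq0 ha hδ k
  have h4 := wpFactor_add_one hq0 ha hε.mul_q k
  have h5 := wpFactor_mul_q hq0 ha hε k
  rw [vwpTerm, vwpTerm, vwpCert, vwpCert, h1, h2, h3, h4]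
  have e2 : q ^ (2 * k) = (q ^ k) ^ 2 := by rw [mul_comm, zpow_mul, zpow_ofNat]
  rw [e2, zpow_add_one₀ (pow_ne_zero 2 ha), mul_zpow (a ^ 2)]
  rw [zpow_add_one₀ hq0] at h5
  generalize wpFactor q a β k = x1
  generalize wpFactor q a γ k = x2
  generalize wpFactor q a δ k = x3
  generalize wpFactor q a ε k = x4 at *
  generalize wpFactor q a (ε * q) k = y at *
  generalize q ^ k = x at *
  generalize (a ^ 2) ^ k = A
  linear_combination (-(1 - a ^ 2 * q * (β * γ * δ * ε)) * (1 - a * x ^ 2) * A * x1 * x2 * x3) * h5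

theorem vwpSum_contiguous {q a β γ δ ε : ℂ} (hq0 : q ≠ 0) (hq : ‖q‖ < 1) (ha : a ≠ 0)
    (hβ : WpRegular q a β) (hγ : WpRegular q a γ) (hδ : WpRegular q a δ) (hε : WpRegular q a ε)
    (hz : ‖a ^ 2 * q * (β * γ * δ * ε)‖ < 1) :
    (1 - ε * q) * (1 - a * ε * q) * (1 - a ^ 2 * q * (β * γ * δ * ε)) * vwpSum q a β γ δ ε
      = (1 - a * q * (β * ε)) * (1 - a * q * (γ * ε)) * (1 - a * q * (δ * ε))
        * vwpSum q a β γ δ (ε * q) := by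
  have hz1 : ‖a ^ 2 * q * (β * γ * δ * (ε * q))‖ < 1 := by
    convert norm_argument_mul_lt hz hq.le using 2
    ring
  -- The argument of the certificate lacks the factor q; evaluating it at εq restores it, so no
  -- stronger convergence condition is needed.
  have hz2 : ‖a ^ 2 * (β * γ * δ * (ε * q))‖ < 1 := by
    convert hz using 2
    ring
  have s1 := (hasSum_vwpTerm hq0 hq ha hz).summable.hasSum
  have s2 := (hasSum_vwpTerm hq0 hq ha hz1).summable.hasSum
  have s3 := (summable_vwpCert hq0 hq ha hβ hγ hδ hε.mul_q hz2).hasSum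
  have s4 := (Equiv.addRight (1 : ℤ)).hasSum_iff.2 s3
  have h := ((s1.mul_left ((1 - ε * q) * (1 - a * ε * q) * (1 - a ^ 2 * q * (β * γ * δ * ε)))).sub
    (s2.mul_left ((1 - a * q * (β * ε)) * (1 - a * q * (γ * ε)) * (1 - a * q * (δ * ε))))).unique
    ((((s4.sub s3).mul_left (ε * q))).congr_fun (fun k => vwpTerm_contiguous hq0 ha hβ hγ hδ hε k))
  rw [sub_self, mul_zero] at h
  exact sub_eq_zero.1 h

/-! ### The product side and iteration of the shift. -/

/-- The denominator of the product side, without the factors depending on `a` only. -/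
def vwpDen (q a β γ δ ε : ℂ) : ℂ :=
  qPochInf q (β * q) * qPochInf q (a * β * q) * (qPochInf q (γ * q) * qPochInf q (a * γ * q))
    * (qPochInf q (δ * q) * qPochInf q (a * δ * q)) * (qPochInf q (ε * q) * qPochInf q (a * ε * q))
    * qPochInf q (a ^ 2 * q * (β * γ * δ * ε))

/-- The numerator of the product side, without the factors depending on `a` only. -/
def vwpNum (q a β γ δ ε : ℂ) : ℂ :=
  qPochInf q (a * q * (β * γ)) * qPochInf q (a * q * (β * δ)) * qPochInf q (a * q * (β * ε))
    * qPochInf q (a * q * (γ * δ)) * qPochInf q (a * q * (γ * ε)) * qPochInf q (a * q * (δ * ε))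

theorem vwpDen_mul_q {q : ℂ} (hq : ‖q‖ < 1) (a β γ δ ε : ℂ) :
    vwpDen q a β γ δ ε = (1 - ε * q) * (1 - a * ε * q) * (1 - a ^ 2 * q * (β * γ * δ * ε))
      * vwpDen q a β γ δ (ε * q) := by
  rw [vwpDen, vwpDen, qPochInf_step hq (ε * q), qPochInf_step hq (a * ε * q),
    qPochInf_step hq (a ^ 2 * q * (β * γ * δ * ε))]
  rw [show a ^ 2 * q * (β * γ * δ * ε) * q = a ^ 2 * q * (β * γ * δ * (ε * q)) by ring,
    show a * (ε * q) * q = a * ε * q * q by ring]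
  ring

theorem vwpNum_mul_q {q : ℂ} (hq : ‖q‖ < 1) (a β γ δ ε : ℂ) :
    vwpNum q a β γ δ ε = (1 - a * q * (β * ε)) * (1 - a * q * (γ * ε)) * (1 - a * q * (δ * ε))
      * vwpNum q a β γ δ (ε * q) := by
  rw [vwpNum, vwpNum, qPochInf_step hq (a * q * (β * ε)), qPochInf_step hq (a * q * (γ * ε)),
    qPochInf_step hq (a * q * (δ * ε))]
  rw [show ∀ x, a * q * (x * ε) * q = a * q * (x * (ε * q)) by intro; ring,
    show ∀ x, a * q * (x * ε) * q = a * q * (x * (ε * q)) by intro; ring,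
    show ∀ x, a * q * (x * ε) * q = a * q * (x * (ε * q)) by intro; ring]
  ring

theorem vwpNum_rotate (q a β γ δ ε : ℂ) : vwpNum q a β γ δ ε = vwpNum q a ε β γ δ := by
  rw [vwpNum, vwpNum, mul_comm ε β, mul_comm ε γ, mul_comm ε δ]
  ring

theorem vwpDen_rotate (q a β γ δ ε : ℂ) : vwpDen q a β γ δ ε = vwpDen q a ε β γ δ := by
  rw [vwpDen, vwpDen, show ε * β * γ * δ = β * γ * δ * ε by ring]
  ring

theorem vwpSum_rotate (q a β γ δ ε : ℂ) : vwpSum q a β γ δ ε = vwpSum q a ε β γ δ := by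
  refine tsum_congr fun k => ?_
  rw [vwpTerm, vwpTerm]
  ring

/-- Hypotheses on the reciprocal parameters under which the sum converges. -/
structure VwpRegular (q a β γ δ ε : ℂ) : Prop where
  one : WpRegular q a β
  two : WpRegular q a γ
  three : WpRegular q a δ
  four : WpRegular q a ε
  norm_lt : ‖a ^ 2 * q * (β * γ * δ * ε)‖ < 1

theorem VwpRegular.step_rotate {q a β γ δ ε : ℂ} (hq : ‖q‖ < 1) (h : VwpRegular q a β γ δ ε) :
    VwpRegular q a (ε * q) β γ δ where
  one := h.four.mul_q
  two := h.one
  three := h.two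
  four := h.three
  norm_lt := by
    convert norm_argument_mul_lt h.norm_lt hq.le using 2
    ring

/-- The shifted parameter moves to the front, so four steps shift all parameters and restore their
order. Sharing a multiplier p avoids division by `vwpNum`, which may vanish. -/
theorem vwpSum_mul_vwpDen_step {q a β γ δ ε : ℂ} (hq0 : q ≠ 0) (hq : ‖q‖ < 1) (ha : a ≠ 0)
    (h : VwpRegular q a β γ δ ε) :
    ∃ p, vwpSum q a β γ δ ε * vwpDen q a β γ δ ε
        = p * (vwpSum q a (ε * q) β γ δ * vwpDen q a (ε * q) β γ δ) ∧
      vwpNum q a β γ δ ε = p * vwpNum q a (ε * q) β γ δ := by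
  refine ⟨_, ?_, (vwpNum_mul_q hq a β γ δ ε).trans (by rw [vwpNum_rotate])⟩
  have h1 := vwpSum_contiguous hq0 hq ha h.one h.two h.three h.four h.norm_lt
  rw [vwpDen_mul_q hq, ← vwpSum_rotate q a β γ δ (ε * q), ← vwpDen_rotate q a β γ δ (ε * q)]
  linear_combination vwpDen q a β γ δ (ε * q) * h1

theorem vwpSum_mul_vwpDen_step_all {q a β γ δ ε : ℂ} (hq0 : q ≠ 0) (hq : ‖q‖ < 1) (ha : a ≠ 0)
    (h : VwpRegular q a β γ δ ε) :
    VwpRegular q a (β * q) (γ * q) (δ * q) (ε * q) ∧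
    ∃ p, vwpSum q a β γ δ ε * vwpDen q a β γ δ ε = p *
        (vwpSum q a (β * q) (γ * q) (δ * q) (ε * q) * vwpDen q a (β * q) (γ * q) (δ * q) (ε * q)) ∧
      vwpNum q a β γ δ ε = p * vwpNum q a (β * q) (γ * q) (δ * q) (ε * q) := by
  have h1 := h.step_rotate hq
  have h2 := h1.step_rotate hq
  have h3 := h2.step_rotate hq
  obtain ⟨p0, e0, f0⟩ := vwpSum_mul_vwpDen_step hq0 hq ha h
  obtain ⟨p1, e1, f1⟩ := vwpSum_mul_vwpDen_step hq0 hq ha h1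
  obtain ⟨p2, e2, f2⟩ := vwpSum_mul_vwpDen_step hq0 hq ha h2
  obtain ⟨p3, e3, f3⟩ := vwpSum_mul_vwpDen_step hq0 hq ha h3
  refine ⟨h3.step_rotate hq, p0 * p1 * p2 * p3, ?_, ?_⟩
  · rw [e0, e1, e2, e3]
    ring
  · rw [f0, f1, f2, f3]
    ring

theorem vwpSum_mul_vwpDen_iterate {q a β γ δ ε : ℂ} (hq0 : q ≠ 0) (hq : ‖q‖ < 1) (ha : a ≠ 0)
    (h : VwpRegular q a β γ δ ε) (m : ℕ) :
    VwpRegular q a (β * q ^ m) (γ * q ^ m) (δ * q ^ m) (ε * q ^ m) ∧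
    ∃ p, vwpSum q a β γ δ ε * vwpDen q a β γ δ ε = p *
        (vwpSum q a (β * q ^ m) (γ * q ^ m) (δ * q ^ m) (ε * q ^ m) *
          vwpDen q a (β * q ^ m) (γ * q ^ m) (δ * q ^ m) (ε * q ^ m)) ∧
      vwpNum q a β γ δ ε = p * vwpNum q a (β * q ^ m) (γ * q ^ m) (δ * q ^ m) (ε * q ^ m) := by
  induction m with
  | zero => exact ⟨by simpa using h, 1, by simp, by simp⟩
  | succ m ih =>
    obtain ⟨hr, p, e, f⟩ := ih
    obtain ⟨hr', p', e', f'⟩ := vwpSum_mul_vwpDen_step_all hq0 hq ha hr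
    simp only [pow_succ, ← mul_assoc] at hr' e' f' ⊢
    refine ⟨hr', p * p', ?_, ?_⟩
    · rw [e, e']
      ring
    · rw [f, f']
      ring

theorem vwpSum_mul_vwpDen {q a β γ δ ε : ℂ} (hq0 : q ≠ 0) (hq : ‖q‖ < 1) (ha : a ≠ 0)
    (h : VwpRegular q a β γ δ ε) :
    vwpSum q a β γ δ ε * vwpDen q a β γ δ ε = vwpNum q a β γ δ ε * vwpSum q a 0 0 0 0 := by
  have hu : Tendsto (fun m : ℕ => q ^ m) atTop (𝓝 0) := tendsto_pow_zero hq
  have hc : ∀ f : ℂ → ℂ, Continuous f → f 0 = 0 →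
      Tendsto (fun m : ℕ => qPochInf q (f (q ^ m))) atTop (𝓝 1) := fun f hf h0 =>
    tendsto_qPochInf_one hq (by simpa [h0, Function.comp_def] using (hf.tendsto 0).comp hu)
  have hD : Tendsto (fun m : ℕ => vwpDen q a (β * q ^ m) (γ * q ^ m) (δ * q ^ m) (ε * q ^ m))
      atTop (𝓝 1) := by
    have h1 := fun x : ℂ => hc (fun y => x * y * q) (by fun_prop) (by simp)
    have h2 := fun x : ℂ => hc (fun y => a * (x * y) * q) (by fun_prop) (by simp)
    have h3 := hc (fun y => a ^ 2 * q * (β * y * (γ * y) * (δ * y) * (ε * y))) (by fun_prop) (by simp)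
    simpa only [vwpDen, mul_one] using (((((h1 β).mul (h2 β)).mul ((h1 γ).mul (h2 γ))).mul
      ((h1 δ).mul (h2 δ))).mul ((h1 ε).mul (h2 ε))).mul h3
  have hN : Tendsto (fun m : ℕ => vwpNum q a (β * q ^ m) (γ * q ^ m) (δ * q ^ m) (ε * q ^ m))
      atTop (𝓝 1) := by
    have h1 := fun x y : ℂ => hc (fun t => a * q * (x * t * (y * t))) (by fun_prop) (by simp)
    simpa only [vwpNum, mul_one] using
      (((((h1 β γ).mul (h1 β δ)).mul (h1 β ε)).mul (h1 γ δ)).mul (h1 γ ε)).mul (h1 δ ε)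
  have hL := hN.const_mul (vwpSum q a β γ δ ε * vwpDen q a β γ δ ε)
  have hR := ((tendsto_vwpSum hq0 hq ha h.norm_lt).mul hD).const_mul (vwpNum q a β γ δ ε)
  simp only [mul_one] at hL hR
  -- For each m the two sequences agree: each equals p times the shifted sum, denominator and
  -- numerator.
  refine tendsto_nhds_unique hL (hR.congr fun m => ?_)
  obtain ⟨-, p, e, f⟩ := vwpSum_mul_vwpDen_iterate hq0 hq ha h m
  rw [e, f]
  ring

/-! ### The constant: all parameters zero. -/

theorem pow_succ_ne_one {q : ℂ} (hq : ‖q‖ < 1) (n : ℕ) : q ^ (n + 1) ≠ 1 := fun h => by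
  have h1 : ‖q‖ ^ (n + 1) < 1 := pow_lt_one₀ (norm_nonneg q) hq n.succ_ne_zero
  rw [← norm_pow, h, norm_one] at h1
  exact lt_irrefl _ h1

theorem qPochInf_self_ne_zero {q : ℂ} (hq : ‖q‖ < 1) : qPochInf q q ≠ 0 :=
  qPochInf_ne_zero hq fun j => by rw [← pow_succ']; exact pow_succ_ne_one hq j

theorem wpFactor_one_natCast_succ (q a : ℂ) (n : ℕ) : wpFactor q a 1 ((n + 1 : ℕ) : ℤ) = 0 := by
  rw [wpFactor_natCast, Finset.prod_range_succ']
  simp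

theorem wpFactor_inv_negSucc {q a : ℂ} (ha : a ≠ 0) (n : ℕ) :
    wpFactor q a a⁻¹ (-((n + 1 : ℕ) : ℤ)) = 0 := by
  rw [wpFactor_neg ha, mul_inv_cancel₀ ha, wpFactor_one_natCast_succ, mul_zero]

/-- The parameter 1 kills all k ≥ 1, and 1/a kills all k ≤ -1. -/
theorem vwpSum_terminating {q a : ℂ} (ha : a ≠ 0) : vwpSum q a 0 0 1 a⁻¹ = 1 - a := by
  rw [vwpSum, tsum_eq_single 0]
  · simp [vwpTerm]
  · intro k hk
    obtain ⟨n, rfl | rfl⟩ := k.eq_nat_or_neg <;> cases n with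
    | zero => simp at hk
    | succ n => simp only [vwpTerm, wpFactor_one_natCast_succ, wpFactor_inv_negSucc ha, mul_zero,
        zero_mul]

theorem wpFactor_zero_sq {q a : ℂ} (hq0 : q ≠ 0) (ha : a ≠ 0) (k : ℤ) :
    wpFactor q a 0 k ^ 2 = q ^ (k * (k - 1)) := by
  have key : ∀ (a : ℂ) (n : ℕ), wpFactor q a 0 n ^ 2 = q ^ ((n : ℤ) * (n - 1)) := fun a n => by
    induction n with
    | zero => simp
    | succ n ih =>
      rw [wpFactor_natCast_succ, mul_pow, ih]
      simp only [mul_zero, zero_mul, sub_zero, div_one, zero_sub, neg_sq]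
      rw [← pow_mul, ← zpow_natCast, ← zpow_add₀ hq0]
      congr 1
      push_cast
      ring
  obtain ⟨n, rfl | rfl⟩ := k.eq_nat_or_neg
  · exact key a n
  · rw [wpFactor_neg ha, mul_zero, mul_pow, key, ← pow_mul, ← zpow_natCast, ← zpow_add₀ hq0]
    congr 1
    push_cast
    ring

/-- The reflection k ↦ -N - k fixes k(k + N) and exchanges -k with k + N, hence swaps the two powers
of q in each term: the sum is its own negative. -/
theorem vwpSum_zero_of_eq_zpow {q a : ℂ} (hq0 : q ≠ 0) {N : ℤ} (h : a = q ^ N) :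
    vwpSum q a 0 0 0 0 = 0 := by
  have ha : a ≠ 0 := h ▸ zpow_ne_zero _ hq0
  have hT : ∀ k, vwpTerm q a 0 0 0 0 k
      = q ^ (2 * k * (k + N) - k) - q ^ (2 * k * (k + N) + k + N) := fun k => by
    rw [vwpTerm, show ∀ x : ℂ, x * x * x * x = x ^ 2 * x ^ 2 by intro; ring,
      wpFactor_zero_sq hq0 ha, h, ← zpow_natCast, ← zpow_mul, ← zpow_add_one₀ hq0, ← zpow_mul,
      ← zpow_add₀ hq0, ← zpow_add₀ hq0, ← zpow_add₀ hq0, sub_mul, one_mul, ← zpow_add₀ hq0]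
    congr 2 <;> push_cast <;> ring
  have h1 : vwpSum q a 0 0 0 0 = -vwpSum q a 0 0 0 0 := by
    conv_lhs => rw [vwpSum, ← (Equiv.subLeft (-N)).tsum_eq]
    rw [vwpSum, ← tsum_neg]
    refine tsum_congr fun k => ?_
    rw [hT, hT, Equiv.subLeft_apply, neg_sub]
    congr 2 <;> ring
  exact self_eq_neg.1 h1

theorem vwpSum_zero {q a : ℂ} (hq0 : q ≠ 0) (hq : ‖q‖ < 1) (ha : a ≠ 0) :
    vwpSum q a 0 0 0 0
      = (1 - a) * (qPochInf q q * qPochInf q (a * q) * qPochInf q (a⁻¹ * q)) := by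
  -- The two exceptional cases, a a negative or a positive power of q, are those in which 1 or 1/a
  -- is not a regular parameter.
  by_cases h : ∃ n : ℕ, a * q ^ (n + 1) = 1
  · obtain ⟨n, hn⟩ := h
    rw [vwpSum_zero_of_eq_zpow hq0 (N := -((n + 1 : ℕ) : ℤ))
      (by rw [zpow_neg, zpow_natCast]; exact eq_inv_of_mul_eq_one_left hn),
      qPochInf_eq_zero hq (x := a * q) (j := n) (by rw [mul_assoc, ← pow_succ']; exact hn)]
    ring
  by_cases h' : ∃ n : ℕ, a⁻¹ * q ^ (n + 1) = 1
  · obtain ⟨n, hn⟩ := h'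
    rw [vwpSum_zero_of_eq_zpow hq0 (N := ((n + 1 : ℕ) : ℤ))
      (by rw [zpow_natCast]; exact (inv_mul_eq_one₀ ha).1 hn),
      qPochInf_eq_zero hq (x := a⁻¹ * q) (j := n) (by rw [mul_assoc, ← pow_succ']; exact hn)]
    ring
  push Not at h h'
  have h0 : WpRegular q a 0 := fun n => by simp
  have hreg : VwpRegular q a 0 0 1 a⁻¹ :=
    ⟨h0, h0, fun n => ⟨by rw [one_mul]; exact sub_ne_zero.2 (pow_succ_ne_one hq n).symm,
      by rw [mul_one]; exact sub_ne_zero.2 (h n).symm⟩,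
      fun n => ⟨sub_ne_zero.2 (h' n).symm,
        by rw [mul_inv_cancel₀ ha, one_mul]; exact sub_ne_zero.2 (pow_succ_ne_one hq n).symm⟩,
      by simp⟩
  have h1 := vwpSum_mul_vwpDen hq0 hq ha hreg
  rw [vwpSum_terminating ha, vwpDen, vwpNum] at h1
  have e : a * q * (1 * a⁻¹) = q := by field_simp
  simp only [mul_zero, zero_mul, qPochInf_zero, one_mul, mul_one, mul_inv_cancel₀ ha] at h1 e
  rw [e] at h1
  refine mul_left_cancel₀ (qPochInf_self_ne_zero hq) ?_
  linear_combination -h1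

/-! ### Return to the classical notation. -/

theorem qPoch_div_qPoch {q a b : ℂ} (hq0 : q ≠ 0) (hb0 : b ≠ 0) (k : ℤ) :
    qPoch q b k / qPoch q (a * q / b) k = b ^ k * wpFactor q a b⁻¹ k := by
  cases k with
  | ofNat n =>
    rw [qPoch, qPoch, ← Finset.prod_div_distrib, Int.ofNat_eq_natCast, wpFactor_natCast,
      zpow_natCast, ← Finset.card_range n, ← Finset.prod_const, Finset.card_range,
      ← Finset.prod_mul_distrib]
    refine Finset.prod_congr rfl fun j _ => ?_
    rw [mul_div_assoc', mul_sub, mul_inv_cancel₀ hb0]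
    congr 2
    rw [pow_succ]
    ring
  | negSucc n =>
    rw [qPoch, qPoch, ← Finset.prod_inv_distrib, ← Finset.prod_inv_distrib,
      ← Finset.prod_div_distrib, wpFactor, zpow_negSucc, ← inv_pow,
      ← Finset.card_range (n + 1), ← Finset.prod_const, Finset.card_range,
      ← Finset.prod_mul_distrib]
    refine Finset.prod_congr rfl fun j _ => ?_
    have e : q ^ (-((j : ℤ) + 1)) = (q ^ (j + 1))⁻¹ := by
      rw [zpow_neg]
      congr 1
    have hj : q ^ (j + 1) ≠ 0 := pow_ne_zero _ hq0
    rw [e, inv_div_inv]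
    generalize q ^ (j + 1) = y at *
    -- If b = q^(j+1), both denominators are 0 and both sides are 0 by the convention on division,
    -- so b need not be regular here.
    by_cases hy : y = b
    · subst hy
      simp [hj]
    · have h1 : 1 - b * y⁻¹ ≠ 0 := fun h => hy (by
        field_simp at h
        linear_combination h)
      have h2 : 1 - b⁻¹ * y ≠ 0 := fun h => hy (by
        field_simp at h
        linear_combination -h)
      rw [mul_div_assoc', div_eq_div_iff h1 h2]
      field_simp
      ring

theorem wpRegular_inv {q a b : ℂ} (hb0 : b ≠ 0)
    (hb : ∀ n : ℕ, b ≠ q ^ (n + 1) ∧ b ≠ a * q ^ (n + 1)) : WpRegular q a b⁻¹ := fun n =>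
  ⟨fun h => (hb n).1 (by field_simp at h; linear_combination h),
    fun h => (hb n).2 (by field_simp at h; linear_combination h)⟩

theorem WpRegular.qPochInf_ne_zero {q a β : ℂ} (hq : ‖q‖ < 1) (h : WpRegular q a β) :
    qPochInf q (β * q) ≠ 0 ∧ qPochInf q (a * β * q) ≠ 0 :=
  ⟨_root_.qPochInf_ne_zero hq fun j => by
      rw [mul_assoc, ← pow_succ']; exact (sub_ne_zero.1 (h j).1).symm,
    _root_.qPochInf_ne_zero hq fun j => by
      rw [mul_assoc, ← pow_succ']; exact (sub_ne_zero.1 (h j).2).symm⟩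

theorem qPochInf_ne_zero_of_norm_lt_one {q x : ℂ} (hq : ‖q‖ < 1) (hx : ‖x‖ < 1) :
    qPochInf q x ≠ 0 := qPochInf_ne_zero hq fun j h => by
  have := norm_argument_mul_lt hx (w := q ^ j)
    (by rw [norm_pow]; exact pow_le_one₀ (norm_nonneg _) hq.le)
  rw [h, norm_one] at this
  exact lt_irrefl _ this

theorem qPoch_mul_q {q x : ℂ} (hq0 : q ≠ 0) (hx : ∀ n : ℕ, 1 - x * q ^ (-(n : ℤ)) ≠ 0) (k : ℤ) :
    (1 - x) * qPoch q (q * x) k = (1 - x * q ^ k) * qPoch q x k := by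
  cases k with
  | ofNat n =>
    rw [qPoch, qPoch, Int.ofNat_eq_natCast, zpow_natCast, mul_comm (1 - x * q ^ n),
      ← Finset.prod_range_succ, Finset.prod_range_succ', pow_zero, mul_one, mul_comm]
    congr 1
    exact Finset.prod_congr rfl fun j _ => by ring
  | negSucc n =>
    rw [qPoch, qPoch]
    have h1 : ∏ j ∈ Finset.range (n + 1), (1 - q * x * q ^ (-((j : ℤ) + 1)))
        = (∏ j ∈ Finset.range n, (1 - x * q ^ (-((j : ℤ) + 1)))) * (1 - x) := by
      rw [Finset.prod_range_succ']
      congr 1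
      · refine Finset.prod_congr rfl fun j _ => ?_
        rw [mul_comm q x, mul_assoc, ← zpow_one_add₀ hq0]
        congr 3
      · simp only [Nat.cast_zero, zero_add, zpow_neg_one]
        field_simp
    have h0 : 1 - x ≠ 0 := by simpa using hx 0
    have h2 := hx (n + 1)
    push_cast at h2
    rw [h1, Finset.prod_range_succ, Int.negSucc_eq, mul_inv, mul_inv, mul_left_comm,
      mul_inv_cancel₀ h0, mul_one, mul_left_comm, mul_inv_cancel₀ h2, mul_one]

theorem qPoch_ne_zero {q x : ℂ} (hx : ∀ m : ℤ, 1 - x * q ^ m ≠ 0) (k : ℤ) : qPoch q x k ≠ 0 := by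
  cases k with
  | ofNat n => exact Finset.prod_ne_zero_iff.2 fun j _ => by simpa using hx j
  | negSucc n => exact inv_ne_zero (Finset.prod_ne_zero_iff.2 fun j _ => hx _)

theorem qPoch_mul_q_div {q x : ℂ} (hq0 : q ≠ 0) (hx : ∀ m : ℤ, 1 - x * q ^ m ≠ 0) (k : ℤ) :
    qPoch q (q * x) k / qPoch q x k = (1 - x * q ^ k) / (1 - x) := by
  have h0 : 1 - x ≠ 0 := by simpa using hx 0
  rw [div_eq_div_iff (qPoch_ne_zero hx k) h0, mul_comm]
  exact qPoch_mul_q hq0 (fun n => hx _) k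

end

theorem mul_bilateralTerm_eq {q a b c d e : ℂ} (hq0 : q ≠ 0) (ha0 : a ≠ 0) (hb0 : b ≠ 0)
    (hc0 : c ≠ 0) (hd0 : d ≠ 0) (he0 : e ≠ 0) (k : ℤ) :
    (1 - a * q ^ (2 * k)) / (1 - a) *
      bilateralTerm ![b, c, d, e] ![a * q / b, a * q / c, a * q / d, a * q / e]
        q (q * a ^ 2 / (b * c * d * e)) k
    = (1 - a)⁻¹ * vwpTerm q a b⁻¹ c⁻¹ d⁻¹ e⁻¹ k := by
  simp only [bilateralTerm, Fin.prod_univ_four, Matrix.cons_val]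
  rw [mul_div_mul_comm, mul_div_mul_comm, mul_div_mul_comm, qPoch_div_qPoch hq0 hb0,
    qPoch_div_qPoch hq0 hc0, qPoch_div_qPoch hq0 hd0, qPoch_div_qPoch hq0 he0, vwpTerm, div_zpow,
    mul_zpow _ e, mul_zpow _ d, mul_zpow b c, mul_comm q (a ^ 2)]
  have h1 := zpow_ne_zero k hb0
  have h2 := zpow_ne_zero k hc0
  have h3 := zpow_ne_zero k hd0
  have h4 := zpow_ne_zero k he0
  generalize wpFactor q a b⁻¹ k = x1
  generalize wpFactor q a c⁻¹ k = x2
  generalize wpFactor q a d⁻¹ k = x3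
  generalize wpFactor q a e⁻¹ k = x4
  field_simp

/-- For x = r and x = -r the quotient (qx)_k/(x)_k telescopes to (1 - xq^k)/(1 - x), and the two
results multiply to (1 - aq^(2k))/(1 - a). That a is no even power of q keeps every factor nonzero.
-/
theorem bilateralTerm_six_eq {q a r b c d e : ℂ} (hq0 : q ≠ 0) (hr : r ^ 2 = a)
    (h : ∀ m : ℤ, a ≠ q ^ (2 * m)) (z : ℂ) (k : ℤ) :
    bilateralTerm ![q * r, -(q * r), b, c, d, e]
        ![r, -r, a * q / b, a * q / c, a * q / d, a * q / e] q z k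
    = (1 - a * q ^ (2 * k)) / (1 - a) *
      bilateralTerm ![b, c, d, e] ![a * q / b, a * q / c, a * q / d, a * q / e] q z k := by
  have hx : ∀ x : ℂ, x ^ 2 = a → ∀ m : ℤ, 1 - x * q ^ m ≠ 0 := fun x hxa m h0 => h (-m) (by
    have h1 : x = q ^ (-m) := by
      rw [zpow_neg]
      exact eq_inv_of_mul_eq_one_left (sub_eq_zero.1 h0).symm
    rw [← hxa, h1, mul_comm, zpow_mul, zpow_ofNat])
  have h1 := qPoch_mul_q_div hq0 (hx r hr) k
  have h2 := qPoch_mul_q_div hq0 (hx (-r) (by rw [neg_sq, hr])) k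
  have e1 : 1 - a * q ^ (2 * k) = (1 - r * q ^ k) * (1 - -r * q ^ k) := by
    rw [mul_comm 2 k, zpow_mul, zpow_ofNat, ← hr]
    ring
  have e2 : 1 - a = (1 - r) * (1 - -r) := by rw [← hr]; ring
  rw [e1, e2, mul_div_mul_comm, ← h1, ← h2]
  simp only [bilateralTerm, Fin.prod_univ_six, Fin.prod_univ_four, Matrix.cons_val, mul_neg]
  ring

theorem mainTheorem1 (q a r b c d e : ℂ)
    (hq0 : q ≠ 0) (hq : ‖q‖ < 1)
    (ha0 : a ≠ 0) (ha1 : a ≠ 1) (hr : r ^ 2 = a)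
    (hb0 : b ≠ 0) (hc0 : c ≠ 0) (hd0 : d ≠ 0) (he0 : e ≠ 0)
    (hb : ∀ n : ℕ, b ≠ q ^ (n + 1) ∧ b ≠ a * q ^ (n + 1))
    (hc : ∀ n : ℕ, c ≠ q ^ (n + 1) ∧ c ≠ a * q ^ (n + 1))
    (hd : ∀ n : ℕ, d ≠ q ^ (n + 1) ∧ d ≠ a * q ^ (n + 1))
    (he : ∀ n : ℕ, e ≠ q ^ (n + 1) ∧ e ≠ a * q ^ (n + 1))
    (hz : ‖a ^ 2 * q / (b * c * d * e)‖ < 1) :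
    -- the series as written, whenever none of its factors is singular
    ((∀ m : ℤ, a ≠ q ^ (2 * m)) →
      Summable (bilateralTerm
        ![q * r, -(q * r), b, c, d, e]
        ![r, -r, a * q / b, a * q / c, a * q / d, a * q / e]
        q (q * a ^ 2 / (b * c * d * e))) ∧
      bilateralPsi
        ![q * r, -(q * r), b, c, d, e]
        ![r, -r, a * q / b, a * q / c, a * q / d, a * q / e]
        q (q * a ^ 2 / (b * c * d * e))
      = qPochInfs q [q, a * q, q / a, a * q / (b * c), a * q / (b * d), a * q / (b * e),
          a * q / (c * d), a * q / (c * e), a * q / (d * e)]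
        / qPochInfs q [q / b, q / c, q / d, q / e, a * q / b, a * q / c, a * q / d, a * q / e,
          a ^ 2 * q / (b * c * d * e)]) ∧
    -- in general, with the square-root factors cancelled to `(1 - a q^{2k}) / (1 - a)`
    HasSum (fun k : ℤ =>
        (1 - a * q ^ (2 * k)) / (1 - a) *
          bilateralTerm ![b, c, d, e] ![a * q / b, a * q / c, a * q / d, a * q / e]
            q (q * a ^ 2 / (b * c * d * e)) k)
      (qPochInfs q [q, a * q, q / a, a * q / (b * c), a * q / (b * d), a * q / (b * e),
          a * q / (c * d), a * q / (c * e), a * q / (d * e)]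
        / qPochInfs q [q / b, q / c, q / d, q / e, a * q / b, a * q / c, a * q / d, a * q / e,
          a ^ 2 * q / (b * c * d * e)]) := by
  have hreg : VwpRegular q a b⁻¹ c⁻¹ d⁻¹ e⁻¹ :=
    ⟨wpRegular_inv hb0 hb, wpRegular_inv hc0 hc, wpRegular_inv hd0 hd, wpRegular_inv he0 he, by
      simpa only [div_eq_mul_inv, mul_inv] using hz⟩
  have hvalue : (1 - a)⁻¹ * vwpSum q a b⁻¹ c⁻¹ d⁻¹ e⁻¹
      = qPochInfs q [q, a * q, q / a, a * q / (b * c), a * q / (b * d), a * q / (b * e),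
          a * q / (c * d), a * q / (c * e), a * q / (d * e)]
        / qPochInfs q [q / b, q / c, q / d, q / e, a * q / b, a * q / c, a * q / d, a * q / e,
          a ^ 2 * q / (b * c * d * e)] := by
    have h1 := vwpSum_mul_vwpDen hq0 hq ha0 hreg
    rw [vwpSum_zero hq0 hq ha0] at h1
    have hden : vwpDen q a b⁻¹ c⁻¹ d⁻¹ e⁻¹ = qPochInfs q [q / b, q / c, q / d, q / e, a * q / b,
        a * q / c, a * q / d, a * q / e, a ^ 2 * q / (b * c * d * e)] := by
      have e1 : ∀ x : ℂ, x⁻¹ * q = q / x := fun x => by ring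
      have e2 : ∀ x : ℂ, a * x⁻¹ * q = a * q / x := fun x => by ring
      have e3 : a ^ 2 * q * (b⁻¹ * c⁻¹ * d⁻¹ * e⁻¹) = a ^ 2 * q / (b * c * d * e) := by
        rw [div_eq_mul_inv, mul_inv, mul_inv, mul_inv]
      simp only [vwpDen, qPochInfs, List.map_cons, List.map_nil, List.prod_cons, List.prod_nil,
        e1, e2, e3]
      ring
    have hnum : qPochInf q q * qPochInf q (a * q) * qPochInf q (a⁻¹ * q)
          * vwpNum q a b⁻¹ c⁻¹ d⁻¹ e⁻¹
        = qPochInfs q [q, a * q, q / a, a * q / (b * c), a * q / (b * d), a * q / (b * e),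
          a * q / (c * d), a * q / (c * e), a * q / (d * e)] := by
      have e1 : a⁻¹ * q = q / a := by ring
      have e2 : ∀ x y : ℂ, a * q * (x⁻¹ * y⁻¹) = a * q / (x * y) := fun x y => by
        rw [div_eq_mul_inv, mul_inv]
      simp only [vwpNum, qPochInfs, List.map_cons, List.map_nil, List.prod_cons, List.prod_nil,
        e1, e2]
      ring
    have hden0 : vwpDen q a b⁻¹ c⁻¹ d⁻¹ e⁻¹ ≠ 0 := by
      have hp : ∀ x, WpRegular q a x → qPochInf q (x * q) * qPochInf q (a * x * q) ≠ 0 :=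
        fun x hx => mul_ne_zero (hx.qPochInf_ne_zero hq).1 (hx.qPochInf_ne_zero hq).2
      exact mul_ne_zero (mul_ne_zero (mul_ne_zero (mul_ne_zero (hp _ hreg.one) (hp _ hreg.two))
        (hp _ hreg.three)) (hp _ hreg.four)) (qPochInf_ne_zero_of_norm_lt_one hq hreg.norm_lt)
    have ha : 1 - a ≠ 0 := sub_ne_zero.2 ha1.symm
    rw [← hden, ← hnum, eq_div_iff hden0, mul_assoc, h1]
    field_simp
  have hsum := ((hasSum_vwpTerm hq0 hq ha0 hreg.norm_lt).summable.hasSum).mul_left (1 - a)⁻¹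
  rw [show ∑' k, vwpTerm q a b⁻¹ c⁻¹ d⁻¹ e⁻¹ k = vwpSum q a b⁻¹ c⁻¹ d⁻¹ e⁻¹ from rfl, hvalue] at hsum
  simp only [← mul_bilateralTerm_eq hq0 ha0 hb0 hc0 hd0 he0] at hsum
  refine ⟨fun h => ?_, hsum⟩
  simp only [← bilateralTerm_six_eq hq0 hr h] at hsum
  exact ⟨hsum.summable, hsum.tsum_eq⟩
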